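/- Let $n\in\mathbb{N}$, $y,a\in\mathbb{R}^n$, $b\in\mathbb{R}$, let $e\in\mathbb{R}^n$ be the all-ones vector and $\Delta=\{x\in\mathbb{R}^n : e^\top x=1,\ x\ge 0\}$, and let $\Pi_\Delta$ be the Euclidean projection onto $\Delta$. Assume that $\mathcal{C}=\{x\in\Delta : a^\top x\le b\}$ is non-empty and that $a\neq b\,e$. For $\sigma\in\mathbb{R}$ put $$h(\sigma)=\min_{x\in\Delta}\Big\{\tfrac12\|x-y\|^2+\sigma(a^\top x-b)\Big\},\qquad \psi(\sigma)=a^\top\Pi_\Delta(y-\sigma a)-b ,$$ and let $\partial\psi(\sigma)$ be Clarke's generalized differential, i.e. the convex hull of all limits $\lim_k\psi'(\sigma_k)$ along sequences $\sigma_k\to\sigma$ of points at which $\psi$ is differentiable. Let $\hat\mu\in(0,1/2)$, $\hat\delta,\hat\tau_1\in(0,1)$, $\hat\tau_2\in(0,1]$ and $\sigma^0\ge 0$. Suppose that $\psi(0)>0$ and that $\{\sigma^j\}_{j\ge0}$ is an infinite sequence generated by the semismooth Newton method with Armijo line search, that is, for every $j\ge 0$: $\psi(\sigma^j)\ne0$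 (the method does not stop); some $\upsilon_j\in\partial\psi(\sigma^j)$ is chosen and $$\Delta\sigma^j=-\frac{\psi(\sigma^j)}{\upsilon_j-\bar\epsilon_j},\qquad \bar\epsilon_j=\hat\tau_2\min\{\hat\tau_1,|\psi(\sigma^j)|\};$$ $m_j$ is the smallest non-negative integer $m$ with $h(\sigma^j+\hat\delta^m\Delta\sigma^j)\ge h(\sigma^j)+\hat\mu\hat\delta^m\psi(\sigma^j)\Delta\sigma^j$; and $\sigma^{j+1}=\sigma^j+\hat\delta^{m_j}\Delta\sigma^j$. Then $\{\sigma^j\}$ is bounded, and every accumulation point $\sigma^*$ of $\{\sigma^j\}$ is an optimal solution of the dual problem $\max_{\sigma\ge0}h(\sigma)$. Moreover, $\sigma^j\to\sigma^*$ and the rate of convergence is quadratic: $|\sigma^{j+1}-\sigma^*|=O(|\sigma^j-\sigma^*|^2)$ as $j\to\infty$. -/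

import Mathlib

open Set Filter Topology Asymptotics

/-- The standard simplex `{x ∈ ℝⁿ | eᵀx = 1, x ≥ 0}`, in Euclidean space. -/
def unitSimplex (n : ℕ) : Set (EuclideanSpace ℝ (Fin n)) :=
  {x | (∀ i, 0 ≤ x i) ∧ ∑ i, x i = 1}

/-- `x` minimizes `½‖w - z‖²` over `w ∈ S`, i.e. `x` is a metric projection of `z` onto `S`. -/
def IsProjOnto {n : ℕ} (S : Set (EuclideanSpace ℝ (Fin n))) (z x : EuclideanSpace ℝ (Fin n)) :
    Prop :=
  x ∈ S ∧ IsMinOn (fun w => (1 / 2 : ℝ) * ‖w - z‖ ^ 2) S x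

/-- The metric projection onto the simplex (see `simplexProj_spec`, `simplexProj_unique`). -/
noncomputable def simplexProj {n : ℕ} (z : EuclideanSpace ℝ (Fin n)) :
    EuclideanSpace ℝ (Fin n) :=
  Classical.epsilon (IsProjOnto (unitSimplex n) z)

/-- The feasible set `C = {x ∈ Δ | aᵀx ≤ b}`. -/
def feasibleSet {n : ℕ} (a : EuclideanSpace ℝ (Fin n)) (b : ℝ) :
    Set (EuclideanSpace ℝ (Fin n)) :=
  {x | inner ℝ a x ≤ b ∧ x ∈ unitSimplex n}

/-- The Lagrangian `½‖x - y‖² + σ(aᵀx - b)` (on the simplex). -/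
noncomputable def lagrangian {n : ℕ} (y a : EuclideanSpace ℝ (Fin n)) (b : ℝ)
    (x : EuclideanSpace ℝ (Fin n)) (σ : ℝ) : ℝ :=
  (1 / 2 : ℝ) * ‖x - y‖ ^ 2 + σ * (inner ℝ a x - b)

/-- The dual function `h(σ) = min_{x ∈ Δ} L(x; σ)`; for `n ≥ 1` the minimum is attained. -/
noncomputable def dualFun {n : ℕ} (y a : EuclideanSpace ℝ (Fin n)) (b σ : ℝ) : ℝ :=
  sInf ((fun x => lagrangian y a b x σ) '' unitSimplex n)

/-- `ψ(σ) = aᵀ Π_Δ(y - σ a) - b`. -/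
noncomputable def psi {n : ℕ} (y a : EuclideanSpace ℝ (Fin n)) (b σ : ℝ) : ℝ :=
  inner ℝ a (simplexProj (y - σ • a)) - b

/-- Optimal solutions of the dual problem `max_{σ ≥ 0} h(σ)`. -/
def IsDualSolution {n : ℕ} (y a : EuclideanSpace ℝ (Fin n)) (b s : ℝ) : Prop :=
  s ∈ Ici (0 : ℝ) ∧ IsMaxOn (dualFun y a b) (Ici 0) s

/-- Clarke's generalized differential of a function of one real variable: the convex hull of all
limits of derivatives at points of differentiability tending to `s`. -/
def clarkeDiff (f : ℝ → ℝ) (s : ℝ) : Set ℝ :=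
  convexHull ℝ {v | ∃ u : ℕ → ℝ, Tendsto u atTop (𝓝 s) ∧ (∀ k, DifferentiableAt ℝ f (u k)) ∧
    Tendsto (fun k => deriv f (u k)) atTop (𝓝 v)}

/-- The regularized Newton direction `-ψ(s) / (v - ε̄)` with `ε̄ = τ₂ min{τ₁, |ψ(s)|}`. -/
noncomputable def newtonDir {n : ℕ} (y a : EuclideanSpace ℝ (Fin n)) (b τ₁ τ₂ s v : ℝ) : ℝ :=
  -psi y a b s / (v - τ₂ * min τ₁ |psi y a b s|)

/-- `σ` is an infinite sequence of iterates of the semismooth Newton method with Armijo line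
search: the initial test `ψ(0) ≤ 0` fails, the stopping test `ψ(σʲ) = 0` never succeeds, `v j` is
the chosen element of the generalized differential at `σʲ`, and `m j` is the exponent found by the
line search. -/
structure IsSSNSequence {n : ℕ} (y a : EuclideanSpace ℝ (Fin n)) (b μ δ τ₁ τ₂ : ℝ)
    (σ v : ℕ → ℝ) (m : ℕ → ℕ) : Prop where
  start_nonneg : 0 ≤ σ 0
  psi_zero_pos : 0 < psi y a b 0
  not_stopped : ∀ j, 0 < |psi y a b (σ j)|
  mem_clarke : ∀ j, v j ∈ clarkeDiff (psi y a b) (σ j)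
  line_search : ∀ j, IsLeast {k : ℕ |
    dualFun y a b (σ j + δ ^ k * newtonDir y a b τ₁ τ₂ (σ j) (v j)) ≥
      dualFun y a b (σ j) +
        μ * δ ^ k * psi y a b (σ j) * newtonDir y a b τ₁ τ₂ (σ j) (v j)} (m j)
  update : ∀ j, σ (j + 1) = σ j + δ ^ m j * newtonDir y a b τ₁ τ₂ (σ j) (v j)

theorem unitSimplex_nonempty {n : ℕ} (hn : 0 < n) : (unitSimplex n).Nonempty := by
  refine ⟨EuclideanSpace.single ⟨0, hn⟩ 1, fun i => ?_, ?_⟩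
  · simp only [EuclideanSpace.single_apply]
    split_ifs <;> norm_num
  · simp [EuclideanSpace.single_apply]

theorem unitSimplex_isClosed (n : ℕ) : IsClosed (unitSimplex n) := by
  have h1 : IsClosed {x : EuclideanSpace ℝ (Fin n) | ∀ i, 0 ≤ x i} := by
    simp only [setOf_forall]
    exact isClosed_iInter fun i => isClosed_le continuous_const (by fun_prop)
  have h2 : IsClosed {x : EuclideanSpace ℝ (Fin n) | ∑ i, x i = 1} :=
    isClosed_eq (by fun_prop) continuous_const
  exact h1.inter h2

theorem unitSimplex_convex (n : ℕ) : Convex ℝ (unitSimplex n) := by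
  intro x hx w hw s t hs ht hst
  refine ⟨fun i => ?_, ?_⟩
  · have := mul_nonneg hs (hx.1 i)
    have := mul_nonneg ht (hw.1 i)
    simp only [PiLp.add_apply, PiLp.smul_apply, smul_eq_mul]
    linarith
  · simp only [PiLp.add_apply, PiLp.smul_apply, smul_eq_mul, Finset.sum_add_distrib,
      ← Finset.mul_sum, hx.2, hw.2]
    linarith

theorem simplexProj_spec {n : ℕ} (hn : 0 < n) (z : EuclideanSpace ℝ (Fin n)) :
    IsProjOnto (unitSimplex n) z (simplexProj z) := by
  obtain ⟨x, hx, hd⟩ :=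
    (unitSimplex_isClosed n).exists_infDist_eq_dist (unitSimplex_nonempty hn) z
  refine Classical.epsilon_spec (p := IsProjOnto (unitSimplex n) z) ⟨x, hx, fun w hw => ?_⟩
  have h : ‖x - z‖ ≤ ‖w - z‖ := by
    rw [← dist_eq_norm, ← dist_eq_norm, dist_comm x, dist_comm w, ← hd]
    exact Metric.infDist_le_dist_of_mem hw
  simp only [mem_setOf_eq]
  gcongr

theorem simplexProj_unique {n : ℕ} (z x : EuclideanSpace ℝ (Fin n))
    (h : IsProjOnto (unitSimplex n) z x) : x = simplexProj z := by
  have h' : IsProjOnto (unitSimplex n) z (simplexProj z) :=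
    Classical.epsilon_spec (p := IsProjOnto (unitSimplex n) z) ⟨x, h⟩
  set w := simplexProj z
  have hm : (1 / 2 : ℝ) • x + (1 / 2 : ℝ) • w ∈ unitSimplex n :=
    unitSimplex_convex n h.1 h'.1 (by norm_num) (by norm_num) (by norm_num)
  have e1 := h.2 h'.1
  have e2 := h'.2 h.1
  have e3 := h.2 hm
  simp only [mem_setOf_eq] at e1 e2 e3
  have hp := parallelogram_law_with_norm ℝ (x - z) (w - z)
  have hs : (x - z) + (w - z) = (2 : ℝ) • ((1 / 2 : ℝ) • x + (1 / 2 : ℝ) • w - z) := by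
    module
  rw [hs, norm_smul, sub_sub_sub_cancel_right, Real.norm_of_nonneg (by norm_num)] at hp
  have : ‖x - w‖ = 0 := by nlinarith [norm_nonneg (x - w)]
  exact sub_eq_zero.1 (norm_eq_zero.1 this)

/-! The dual function `h` is concave with Lipschitz derivative `ψ`. The projection is
soft-thresholding, and for a fixed support it is affine in `σ`, so `ψ` is continuous, antitone and
piecewise affine (`psi_isPiecewiseAffine`). Globally, `armijo_increase` shows that each step raises
`h` by at least a constant times `ψ(σʲ)²`. A feasible point bounds `h` above on `σ ≥ 0`, which
forces `ψ` to have a zero; that zero maximizes `h` on the whole line. Hence `ψ(σʲ) → 0`, and cluster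
points are zeros of `ψ`, that is, maximizers of `h`. Locally, `ψ` is linear on each side of a zero
`s`, so at nearby iterates the Clarke differential contains only the slope `p` of the piece ending
at `s`. The regularization `ε ≤ |ψ|` keeps the Newton step from overshooting `s` and leaves an error
at most `|σʲ - s|²`. On that piece `h` is quadratic, so `μ < 1/2` makes the line search accept the
full step (`newton_step_of_linear`). -/

/-! ### Projection onto the simplex -/

section Simplex

variable {n : ℕ}

/-- Existence of the threshold in the soft-thresholding formula for the projection. -/
theorem exists_threshold (hn : 0 < n) (z : Fin n → ℝ) :
    ∃ θ : ℝ, ∑ i, max (z i - θ) 0 = 1 := by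
  have hc : Continuous fun θ : ℝ => ∑ i, max (z i - θ) 0 := by fun_prop
  obtain ⟨M, hM⟩ := (finite_range z).bddAbove
  have h0 : ∑ i, max (z i - M) 0 = 0 :=
    Finset.sum_eq_zero fun i _ => max_eq_right (sub_nonpos.2 (hM (mem_range_self i)))
  have h1 : 1 ≤ ∑ i, max (z i - (z ⟨0, hn⟩ - 1)) 0 := by
    have := Finset.single_le_sum (f := fun i => max (z i - (z ⟨0, hn⟩ - 1)) 0)
      (fun i _ => le_max_right _ _) (Finset.mem_univ ⟨0, hn⟩)
    refine le_trans ?_ this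
    simp
  exact mem_range_of_exists_le_of_exists_ge hc ⟨M, by rw [h0]; norm_num⟩ ⟨_, h1⟩

/-- The point of `ℝⁿ` with coordinates `z i - θ` on `I` and `0` elsewhere. -/
noncomputable def shiftedPoint (z : EuclideanSpace ℝ (Fin n)) (I : Finset (Fin n)) (θ : ℝ) :
    EuclideanSpace ℝ (Fin n) :=
  WithLp.toLp 2 fun i => if i ∈ I then z i - θ else 0

/-- The optimality conditions of the projection onto the simplex, with support in `I` and
multiplier `θ`. -/
def IsThreshold (z : EuclideanSpace ℝ (Fin n)) (I : Finset (Fin n)) (θ : ℝ) : Prop :=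
  (∀ i ∈ I, θ ≤ z i) ∧ (∀ i ∉ I, z i ≤ θ) ∧ ∑ i ∈ I, (z i - θ) = 1

theorem exists_isThreshold (hn : 0 < n) (z : EuclideanSpace ℝ (Fin n)) :
    ∃ I θ, IsThreshold z I θ := by
  obtain ⟨θ, hθ⟩ := exists_threshold hn z
  refine ⟨Finset.univ.filter fun i => θ ≤ z i, θ, ?_, ?_, ?_⟩
  · intro i hi
    simpa using hi
  · intro i hi
    simp only [Finset.mem_filter, Finset.mem_univ, true_and, not_le] at hi
    exact hi.le
  · rw [← hθ, Finset.sum_filter]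
    refine Finset.sum_congr rfl fun i _ => ?_
    split_ifs with h
    · rw [max_eq_left (sub_nonneg.2 h)]
    · rw [max_eq_right (by linarith)]

theorem IsThreshold.mem_unitSimplex {z : EuclideanSpace ℝ (Fin n)} {I : Finset (Fin n)} {θ : ℝ}
    (h : IsThreshold z I θ) : shiftedPoint z I θ ∈ unitSimplex n := by
  refine ⟨fun i => ?_, ?_⟩
  · simp only [shiftedPoint]
    split_ifs with hi
    · exact sub_nonneg.2 (h.1 i hi)
    · exact le_rfl
  · simpa [shiftedPoint, Finset.sum_ite_mem] using h.2.2

/-- On `I` the residual `z - x` equals `θ`, and off `I` it is at most `θ` where `x` vanishes. The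
resulting bound `θ * ∑ (w i - x i)` is zero because both points have coordinate sum one. -/
theorem IsThreshold.inner_le_zero {z : EuclideanSpace ℝ (Fin n)} {I : Finset (Fin n)} {θ : ℝ}
    (h : IsThreshold z I θ) {w : EuclideanSpace ℝ (Fin n)} (hw : w ∈ unitSimplex n) :
    inner ℝ (z - shiftedPoint z I θ) (w - shiftedPoint z I θ) ≤ 0 := by
  have hx := h.mem_unitSimplex
  set x := shiftedPoint z I θ with hxdef
  have hle : inner ℝ (z - x) (w - x) ≤ ∑ i, θ * (w i - x i) := by
    rw [PiLp.inner_apply]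
    refine Finset.sum_le_sum fun i _ => ?_
    simp only [PiLp.sub_apply, RCLike.inner_apply, conj_trivial]
    by_cases hi : i ∈ I
    · have : x i = z i - θ := by simp [hxdef, shiftedPoint, hi]
      rw [this]
      apply le_of_eq
      ring
    · have h0 : x i = 0 := by simp [hxdef, shiftedPoint, hi]
      rw [h0]
      have := mul_le_mul_of_nonneg_right (h.2.1 i hi) (hw.1 i)
      linarith
  rw [← Finset.mul_sum, Finset.sum_sub_distrib, hw.2, hx.2] at hle
  linarith

theorem IsThreshold.simplexProj_eq {z : EuclideanSpace ℝ (Fin n)} {I : Finset (Fin n)} {θ : ℝ}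
    (h : IsThreshold z I θ) : simplexProj z = shiftedPoint z I θ := by
  symm
  refine simplexProj_unique z _ ⟨h.mem_unitSimplex, fun w hw => ?_⟩
  have hin := h.inner_le_zero hw
  set x := shiftedPoint z I θ
  have e : w - z = (w - x) - (z - x) := by abel
  have e' : ‖w - z‖ ^ 2 = ‖w - x‖ ^ 2 - 2 * inner ℝ (w - x) (z - x) + ‖z - x‖ ^ 2 := by
    rw [e]; exact norm_sub_sq_real _ _
  rw [real_inner_comm] at hin
  simp only [mem_ofPred_eq]
  rw [e', norm_sub_rev x z]
  nlinarith [sq_nonneg ‖w - x‖]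

theorem simplexProj_inner_le_zero (hn : 0 < n) (z : EuclideanSpace ℝ (Fin n))
    {w : EuclideanSpace ℝ (Fin n)} (hw : w ∈ unitSimplex n) :
    inner ℝ (z - simplexProj z) (w - simplexProj z) ≤ 0 := by
  obtain ⟨I, θ, h⟩ := exists_isThreshold hn z
  rw [h.simplexProj_eq]
  exact h.inner_le_zero hw

/-- Adding the variational inequalities at the two projections gives firm nonexpansiveness;
Cauchy–Schwarz finishes. -/
theorem norm_simplexProj_sub_le (hn : 0 < n) (z z' : EuclideanSpace ℝ (Fin n)) :
    ‖simplexProj z - simplexProj z'‖ ≤ ‖z - z'‖ := by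
  have h1 := simplexProj_inner_le_zero hn z (simplexProj_spec hn z').1
  have h2 := simplexProj_inner_le_zero hn z' (simplexProj_spec hn z).1
  set x := simplexProj z
  set x' := simplexProj z'
  have key : ‖x - x'‖ ^ 2 ≤ inner ℝ (z - z') (x - x') := by
    rw [← real_inner_self_eq_norm_sq]
    have e : inner ℝ (z - x) (x' - x) + inner ℝ (z' - x') (x - x')
        = inner ℝ (x - x') (x - x') - inner ℝ (z - z') (x - x') := by
      rw [← neg_sub x x', inner_neg_right, neg_add_eq_sub, ← inner_sub_left, ← inner_sub_left]
      congr 1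
      abel
    linarith
  have hcs := real_inner_le_norm (z - z') (x - x')
  by_contra! hlt
  nlinarith [norm_nonneg (z - z'), norm_nonneg (x - x')]

end Simplex

/-! ### The dual function and its supergradient -/

section Dual

variable {n : ℕ} (y a : EuclideanSpace ℝ (Fin n)) (b : ℝ)

/-- Completing the square: the remainder does not depend on `x`, so minimizing over the simplex
amounts to projecting `y - σ • a`. -/
theorem lagrangian_eq (x : EuclideanSpace ℝ (Fin n)) (σ : ℝ) :
    lagrangian y a b x σ = (1 / 2 : ℝ) * ‖x - (y - σ • a)‖ ^ 2
      + (σ * inner ℝ a y - σ ^ 2 / 2 * ‖a‖ ^ 2 - σ * b) := by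
  have e : x - (y - σ • a) = (x - y) + σ • a := by abel
  have e' := norm_add_sq_real (x - y) (σ • a)
  rw [← e, inner_smul_right, inner_sub_left, norm_smul, mul_pow, Real.norm_eq_abs, sq_abs,
    real_inner_comm, real_inner_comm a y] at e'
  rw [e', lagrangian]
  ring

theorem dualFun_eq (hn : 0 < n) (σ : ℝ) :
    dualFun y a b σ = lagrangian y a b (simplexProj (y - σ • a)) σ := by
  have hp := simplexProj_spec hn (y - σ • a)
  refine IsLeast.csInf_eq ⟨mem_image_of_mem _ hp.1, ?_⟩
  rintro _ ⟨w, hw, rfl⟩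
  have := hp.2 hw
  simp only [mem_ofPred_eq] at this
  simp only [lagrangian_eq]
  linarith

theorem dualFun_le_lagrangian (hn : 0 < n) (σ : ℝ) {x : EuclideanSpace ℝ (Fin n)}
    (hx : x ∈ unitSimplex n) : dualFun y a b σ ≤ lagrangian y a b x σ := by
  have := (simplexProj_spec hn (y - σ • a)).2 hx
  simp only [mem_ofPred_eq] at this
  rw [dualFun_eq y a b hn, lagrangian_eq, lagrangian_eq]
  linarith

/-- `ψ(σ)` is a supergradient of the dual function at `σ`. -/
theorem dualFun_le_add_psi_mul (hn : 0 < n) (σ τ : ℝ) :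
    dualFun y a b τ ≤ dualFun y a b σ + psi y a b σ * (τ - σ) := by
  have := dualFun_le_lagrangian y a b hn τ (simplexProj_spec hn (y - σ • a)).1
  rw [dualFun_eq y a b hn σ, psi]
  simp only [lagrangian] at this ⊢
  linarith

theorem abs_psi_sub_le (hn : 0 < n) (σ τ : ℝ) :
    -- The `+ 1` keeps the constant positive when `a = 0`.
    |psi y a b σ - psi y a b τ| ≤ (‖a‖ ^ 2 + 1) * |σ - τ| := by
  have h1 := norm_simplexProj_sub_le hn (y - σ • a) (y - τ • a)
  have e : (y - σ • a) - (y - τ • a) = (τ - σ) • a := by module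
  rw [e, norm_smul, Real.norm_eq_abs, abs_sub_comm] at h1
  have e2 : psi y a b σ - psi y a b τ
      = inner ℝ a (simplexProj (y - σ • a) - simplexProj (y - τ • a)) := by
    rw [psi, psi, inner_sub_right]; ring
  rw [e2]
  calc _ ≤ ‖a‖ * ‖simplexProj (y - σ • a) - simplexProj (y - τ • a)‖ :=
        abs_real_inner_le_norm _ _
    _ ≤ ‖a‖ * (|σ - τ| * ‖a‖) := by gcongr
    _ ≤ _ := by nlinarith [abs_nonneg (σ - τ)]

end Dual

/-! ### Piecewise affine functions -/

/-- `f` is affine on each of finitely many convex sets that cover the line. -/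
def IsPiecewiseAffine (f : ℝ → ℝ) : Prop :=
  ∃ (ι : Type) (_ : Finite ι) (R : ι → Set ℝ) (p q : ι → ℝ),
    (∀ i, (R i).OrdConnected) ∧ (∀ x, ∃ i, x ∈ R i) ∧ ∀ i, ∀ x ∈ R i, f x = p i * x + q i

/-- Pieces are indexed by the support `I`. The threshold conditions are jointly affine in `(σ, θ)`,
so their solutions project to a convex set of `σ`; the sum condition determines `θ` as an affine
function of `σ`. -/
theorem psi_isPiecewiseAffine {n : ℕ} (hn : 0 < n) (y a : EuclideanSpace ℝ (Fin n)) (b : ℝ) :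
    IsPiecewiseAffine (psi y a b) := by
  classical
  let c : Finset (Fin n) → ℝ := fun I => (I.card : ℝ)⁻¹
  refine ⟨Finset (Fin n), inferInstance, fun I => {σ | ∃ θ, IsThreshold (y - σ • a) I θ},
    fun I => -∑ i ∈ I, a i * (a i - c I * ∑ k ∈ I, a k),
    fun I => ∑ i ∈ I, a i * (y i - c I * (∑ k ∈ I, y k - 1)) - b, fun I => ?_, fun σ => ?_, ?_⟩
  · apply Convex.ordConnected
    rintro s ⟨θ, h1, h2, h3⟩ t ⟨η, g1, g2, g3⟩ u w hu hw huw
    refine ⟨u * θ + w * η, fun i hi => ?_, fun i hi => ?_, ?_⟩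
    · have e1 := mul_le_mul_of_nonneg_left (h1 i hi) hu
      have e2 := mul_le_mul_of_nonneg_left (g1 i hi) hw
      simp only [PiLp.sub_apply, PiLp.smul_apply, smul_eq_mul] at e1 e2 ⊢
      obtain rfl : w = 1 - u := by linarith
      linarith
    · have e1 := mul_le_mul_of_nonneg_left (h2 i hi) hu
      have e2 := mul_le_mul_of_nonneg_left (g2 i hi) hw
      simp only [PiLp.sub_apply, PiLp.smul_apply, smul_eq_mul] at e1 e2 ⊢
      obtain rfl : w = 1 - u := by linarith
      linarith
    · have : u * ∑ i ∈ I, ((y - s • a) i - θ) + w * ∑ i ∈ I, ((y - t • a) i - η) = 1 := by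
        rw [h3, g3]; linarith
      rw [Finset.mul_sum, Finset.mul_sum, ← Finset.sum_add_distrib] at this
      rw [← this]
      refine Finset.sum_congr rfl fun i _ => ?_
      simp only [PiLp.sub_apply, PiLp.smul_apply, smul_eq_mul]
      obtain rfl : w = 1 - u := by linarith
      ring
  · exact exists_isThreshold hn _
  · rintro I σ ⟨θ, h⟩
    have hI : (I.card : ℝ) ≠ 0 := by
      intro h0
      have : I = ∅ := by simpa using h0
      simpa [this] using h.2.2
    have hθ : θ = c I * (∑ k ∈ I, y k - σ * ∑ k ∈ I, a k - 1) := by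
      have := h.2.2
      simp only [PiLp.sub_apply, PiLp.smul_apply, smul_eq_mul, Finset.sum_sub_distrib,
        ← Finset.mul_sum, Finset.sum_const, nsmul_eq_mul] at this
      simp only [c]
      field_simp
      linarith
    rw [psi, h.simplexProj_eq, PiLp.inner_apply]
    simp only [shiftedPoint, RCLike.inner_apply, conj_trivial, ite_mul, zero_mul,
      Finset.sum_ite_mem, Finset.univ_inter]
    rw [← sub_eq_zero, hθ]
    have : ∀ A B C : ℝ, A - b - (-B * σ + (C - b)) = A + B * σ - C := by intros; ring
    rw [this, Finset.sum_mul, ← Finset.sum_add_distrib, ← Finset.sum_sub_distrib]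
    refine Finset.sum_eq_zero fun i _ => ?_
    simp only [PiLp.sub_apply, PiLp.smul_apply, smul_eq_mul]
    ring

section PiecewiseAffine

variable {f : ℝ → ℝ}

theorem IsPiecewiseAffine.exists_frequently (hf : IsPiecewiseAffine f) (l : Filter ℝ) [l.NeBot] :
    ∃ (R : Set ℝ) (p q : ℝ), R.OrdConnected ∧ (∃ᶠ x in l, x ∈ R) ∧ ∀ x ∈ R, f x = p * x + q := by
  obtain ⟨ι, _, R, p, q, hR, hcov, hpq⟩ := hf
  obtain ⟨i, hi⟩ : ∃ i, ∃ᶠ x in l, x ∈ R i := by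
    by_contra! h
    have h' : ∀ᶠ x in l, ∀ i, x ∉ R i := eventually_all.2 fun i => by simpa using h i
    obtain ⟨x, hx⟩ := h'.exists
    obtain ⟨i, hi⟩ := hcov x
    exact hx i hi
  exact ⟨R i, p i, q i, hR i, hi, hpq i⟩

theorem IsPiecewiseAffine.eventually_atTop (hf : IsPiecewiseAffine f) :
    ∃ T p q : ℝ, ∀ x ≥ T, f x = p * x + q := by
  obtain ⟨R, p, q, hR, hfr, hpq⟩ := hf.exists_frequently atTop
  obtain ⟨T, hT⟩ := hfr.exists
  refine ⟨T, p, q, fun x hx => hpq x ?_⟩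
  obtain ⟨z, hz, hzR⟩ := frequently_atTop.1 hfr x
  exact hR.out hT hzR ⟨hx, hz⟩

theorem IsPiecewiseAffine.exists_right (hf : IsPiecewiseAffine f) (hc : Continuous f) (s : ℝ) :
    ∃ p, ∃ r > 0, ∀ x ∈ Icc s (s + r), f x = f s + p * (x - s) := by
  obtain ⟨R, p, q, hR, hfr, hpq⟩ := hf.exists_frequently (𝓝[>] s)
  obtain ⟨z, hzR, hz⟩ := (hfr.and_eventually self_mem_nhdsWithin).exists
  have hz : s < z := hz
  have hmem : ∀ x ∈ Ioc s z, f x = p * x + q := fun x hx => by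
    obtain ⟨w, hwR, hw⟩ := (hfr.and_eventually (Ioo_mem_nhdsGT hx.1)).exists
    exact hpq x (hR.out hwR hzR ⟨hw.2.le, hx.2⟩)
  -- The piece need not contain `s`; continuity extends its formula to the endpoint.
  have hs : f s = p * s + q := by
    have h1 : Tendsto f (𝓝[>] s) (𝓝 (f s)) := hc.continuousAt.tendsto.mono_left nhdsWithin_le_nhds
    have h2 : Tendsto (fun x => p * x + q) (𝓝[>] s) (𝓝 (p * s + q)) :=
      (Continuous.tendsto (by fun_prop) s).mono_left nhdsWithin_le_nhds
    refine tendsto_nhds_unique h1 (h2.congr' ?_)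
    filter_upwards [Ioc_mem_nhdsGT hz] with x hx using (hmem x hx).symm
  refine ⟨p, z - s, sub_pos.2 hz, fun x hx => ?_⟩
  rcases hx.1.eq_or_lt with rfl | h
  · ring
  · rw [hmem x ⟨h, by linarith [hx.2]⟩, hs]
    ring

theorem IsPiecewiseAffine.comp_neg (hf : IsPiecewiseAffine f) :
    IsPiecewiseAffine fun x => f (-x) := by
  obtain ⟨ι, hι, R, p, q, hR, hcov, hpq⟩ := hf
  refine ⟨ι, hι, fun i => {x | -x ∈ R i}, fun i => -p i, q, fun i => ⟨?_⟩, fun x => hcov (-x),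
    fun i x hx => ?_⟩
  · intro x hx z hz w hw
    exact (hR i).out hz hx ⟨neg_le_neg hw.2, neg_le_neg hw.1⟩
  · have := hpq i (-x) hx
    simp only [this]
    ring

theorem IsPiecewiseAffine.exists_left (hf : IsPiecewiseAffine f) (hc : Continuous f) (s : ℝ) :
    ∃ p, ∃ r > 0, ∀ x ∈ Icc (s - r) s, f x = f s + p * (x - s) := by
  obtain ⟨p, r, hr, h⟩ := hf.comp_neg.exists_right (hc.comp continuous_neg) (-s)
  refine ⟨-p, r, hr, fun x hx => ?_⟩
  have := h (-x) ⟨by linarith [hx.2], by linarith [hx.1]⟩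
  simp only [neg_neg] at this
  rw [this]
  ring

/-- Near a zero `s`, a continuous piecewise affine function is linear in `w - s` on each side. -/
theorem IsPiecewiseAffine.exists_near_zero (hf : IsPiecewiseAffine f) (hc : Continuous f) {s : ℝ}
    (hs : f s = 0) : ∃ r > 0, ∀ x, |x - s| < r → x ≠ s →
      ∃ p, (∀ w ∈ uIcc x s, f w = p * (w - s)) ∧ ∀ᶠ w in 𝓝 x, f w = p * (w - s) := by
  obtain ⟨p, r, hr, h⟩ := hf.exists_right hc s
  obtain ⟨p', r', hr', h'⟩ := hf.exists_left hc s
  refine ⟨min r r', lt_min hr hr', fun x hx hxs => ?_⟩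
  have h1 := abs_lt.1 (hx.trans_le (min_le_left _ _))
  have h2 := abs_lt.1 (hx.trans_le (min_le_right _ _))
  rcases lt_or_gt_of_ne hxs with hlt | hlt
  · have key : ∀ w ∈ Icc (s - r') s, f w = p' * (w - s) := fun w hw => by rw [h' w hw, hs, zero_add]
    refine ⟨p', fun w hw => ?_, ?_⟩
    · rw [uIcc_of_le hlt.le] at hw
      exact key w ⟨by linarith [hw.1], hw.2⟩
    · filter_upwards [Icc_mem_nhds (by linarith : s - r' < x) hlt] using key
  · have key : ∀ w ∈ Icc s (s + r), f w = p * (w - s) := fun w hw => by rw [h w hw, hs, zero_add]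
    refine ⟨p, fun w hw => ?_, ?_⟩
    · rw [uIcc_of_ge hlt.le] at hw
      exact key w ⟨hw.1, by linarith [hw.2]⟩
    · filter_upwards [Icc_mem_nhds hlt (by linarith : x < s + r)] using key

end PiecewiseAffine

/-! ### Bounds on the Clarke differential -/

section Clarke

theorem clarkeDiff_subset_Icc {f : ℝ → ℝ} {L : ℝ} (hf : Antitone f)
    (hlip : ∀ x z, |f x - f z| ≤ L * |x - z|) (hL : 0 ≤ L) (s : ℝ) :
    clarkeDiff f s ⊆ Icc (-L) 0 := by
  refine convexHull_min ?_ (convex_Icc _ _)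
  rintro v ⟨u, -, -, hv⟩
  refine isClosed_Icc.mem_of_tendsto hv (Eventually.of_forall fun k => ⟨?_, hf.deriv_nonpos⟩)
  have hl : LipschitzWith ⟨L, hL⟩ f := LipschitzWith.of_dist_le_mul fun x z => hlip x z
  have := norm_deriv_le_of_lipschitz hl (x₀ := u k)
  exact (abs_le.1 this).1

theorem clarkeDiff_subset_singleton {f : ℝ → ℝ} {p c s : ℝ}
    (h : ∀ᶠ w in 𝓝 s, f w = p * (w - c)) : clarkeDiff f s ⊆ {p} := by
  refine convexHull_min ?_ (convex_singleton p)
  rintro v ⟨u, hu, -, hv⟩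
  have hd : ∀ᶠ w in 𝓝 s, deriv f w = p := by
    filter_upwards [h.eventually_nhds] with w hw
    have h1 : HasDerivAt (fun w => p * (w - c)) p w := by
      simpa using ((hasDerivAt_id w).sub_const c).const_mul p
    exact (h1.congr_of_eventuallyEq hw).deriv
  exact tendsto_nhds_unique hv (tendsto_const_nhds.congr'
    ((hu.eventually hd).mono fun k hk => hk.symm))

end Clarke

/-! ### Concave functions with a Lipschitz supergradient -/

section Concave

variable {f h : ℝ → ℝ} {L : ℝ}

theorem antitone_of_supergradient (hsup : ∀ σ τ, h τ ≤ h σ + f σ * (τ - σ)) : Antitone f := by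
  intro x z hxz
  rcases hxz.eq_or_lt with rfl | hlt
  · exact le_rfl
  have h1 := hsup x z
  have h2 := hsup z x
  by_contra! hc
  nlinarith

/-- The supergradient inequality is taken at `x + d` and evaluated at `x`; replacing `f (x + d)` by
`f x` costs at most `L * d ^ 2`. -/
theorem quadratic_lower_bound (hsup : ∀ σ τ, h τ ≤ h σ + f σ * (τ - σ))
    (hlip : ∀ x z, |f x - f z| ≤ L * |x - z|) (x d : ℝ) :
    h x + f x * d - L * d ^ 2 ≤ h (x + d) := by
  have h1 := hsup (x + d) x
  have h2 := hlip (x + d) x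
  have h3 : -((f (x + d) - f x) * d) ≤ L * d ^ 2 := by
    calc _ ≤ |(f (x + d) - f x) * d| := neg_le_abs _
      _ = |f (x + d) - f x| * |d| := abs_mul _ _
      _ ≤ L * |x + d - x| * |d| := by gcongr
      _ = L * d ^ 2 := by rw [add_sub_cancel_left, mul_assoc, abs_mul_abs_self, sq]
  nlinarith

theorem hasDerivAt_of_supergradient (hsup : ∀ σ τ, h τ ≤ h σ + f σ * (τ - σ))
    (hlip : ∀ x z, |f x - f z| ≤ L * |x - z|) (x : ℝ) : HasDerivAt h (f x) x := by
  rw [hasDerivAt_iff_isLittleO, isLittleO_iff]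
  intro c hc
  have hcont : Tendsto (fun w : ℝ => L * |w - x|) (𝓝 x) (𝓝 0) := by
    have : Continuous fun w : ℝ => L * |w - x| := by fun_prop
    simpa using this.tendsto x
  filter_upwards [hcont.eventually_lt_const hc] with w hw
  have h1 := hsup x w
  have h2 := quadratic_lower_bound hsup hlip x (w - x)
  rw [add_sub_cancel] at h2
  rw [Real.norm_eq_abs, Real.norm_eq_abs, smul_eq_mul, abs_le]
  have h3 : L * (w - x) ^ 2 ≤ c * |w - x| := by
    rw [← sq_abs, sq, ← mul_assoc]
    gcongr
  have h4 : 0 ≤ c * |w - x| := by positivity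
  constructor <;> linarith

/-- A primitive of a function that is affine on a segment is quadratic there. -/
theorem primitive_of_affine (hd : ∀ x, HasDerivAt h (f x) x) {x d p : ℝ}
    (haff : ∀ t ∈ Icc (0 : ℝ) 1, f (x + t * d) = f x + p * (t * d)) :
    h (x + d) = h x + f x * d + p * d ^ 2 / 2 := by
  let g : ℝ → ℝ := fun t => h (x + t * d) - (t * (f x * d) + p * d ^ 2 / 2 * t ^ 2)
  have hg : ∀ t, HasDerivAt g (f (x + t * d) * d - (f x * d + p * d ^ 2 / 2 * (2 * t))) t := by
    intro t
    have h1 : HasDerivAt (fun t : ℝ => x + t * d) d t := by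
      simpa using ((hasDerivAt_id t).mul_const d).const_add x
    have h2 : HasDerivAt (fun t : ℝ => t * (f x * d) + p * d ^ 2 / 2 * t ^ 2)
        (f x * d + p * d ^ 2 / 2 * (2 * t)) t := by
      have h3 := ((hasDerivAt_id' t).mul_const (f x * d)).fun_add
        ((hasDerivAt_pow 2 t).const_mul (p * d ^ 2 / 2))
      simpa using h3
    exact ((hd _).comp t h1).sub h2
  obtain ⟨c, hc, hslope⟩ := exists_hasDerivAt_eq_slope g _ zero_lt_one
    (fun t _ => (hg t).continuousAt.continuousWithinAt) (fun t _ => hg t)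
  rw [haff c ⟨hc.1.le, hc.2.le⟩] at hslope
  simp only [g, one_mul, zero_mul, add_zero] at hslope
  linarith

end Concave

/-! ### One regularized Newton step -/

section Newton

variable {f h : ℝ → ℝ} {L μ δ : ℝ}

/-- The increase of `h` in one damped Newton step with Armijo line search. -/
theorem armijo_increase (hsup : ∀ σ τ, h τ ≤ h σ + f σ * (τ - σ))
    (hlip : ∀ x z, |f x - f z| ≤ L * |x - z|) (hL : 0 < L) (hμ : μ ∈ Ioo (0 : ℝ) (1 / 2))
    (hδ : δ ∈ Ioo (0 : ℝ) 1) {x v ε d : ℝ} {m : ℕ} (hx : f x ≠ 0) (hv : v ∈ Icc (-L) 0)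
    (hε : ε ∈ Ioc (0 : ℝ) 1) (hd : d = -f x / (v - ε))
    (hm : IsLeast {k : ℕ | h (x + δ ^ k * d) ≥ h x + μ * δ ^ k * f x * d} m) :
    h x + μ * min (δ / (2 * L)) (1 / (L + 1)) * f x ^ 2 ≤ h (x + δ ^ m * d) := by
  obtain ⟨hμ0, hμ1⟩ := hμ
  obtain ⟨hδ0, hδ1⟩ := hδ
  obtain ⟨w, hw⟩ : ∃ w, w = ε - v := ⟨_, rfl⟩
  have hw0 : 0 < w := by linarith [hε.1, hv.2]
  have hwL : w ≤ L + 1 := by linarith [hε.2, hv.1]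
  have hdw : d = f x / w := by
    rw [hd, hw, neg_div, ← div_neg, neg_sub]
  have hfd : f x * d = f x ^ 2 / w := by rw [hdw]; ring
  have hfx : 0 < f x ^ 2 := by positivity
  have hle := hm.1
  simp only [mem_ofPred_eq, ge_iff_le] at hle
  refine le_trans ?_ hle
  rw [add_le_add_iff_left, mul_assoc _ (f x) d, hfd, mul_assoc μ, mul_assoc μ]
  refine mul_le_mul_of_nonneg_left ?_ hμ0.le
  rw [← mul_div_assoc, mul_comm (δ ^ m), mul_div_assoc, mul_comm _ (f x ^ 2)]
  refine mul_le_mul_of_nonneg_left ?_ hfx.le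
  rcases m with _ | k
  · refine (min_le_right _ _).trans ?_
    rw [pow_zero]
    exact one_div_le_one_div_of_le hw0 hwL
  · refine (min_le_left _ _).trans ?_
    -- The last rejected trial `δ ^ k` violates Armijo; against the quadratic lower bound this gives
    -- `(1 - μ) * w < L * δ ^ k`, so the step length cannot be too small.
    have hk : ¬ h (x + δ ^ k * d) ≥ h x + μ * δ ^ k * f x * d := fun hk => by
      have := hm.2 hk
      omega
    have ht : 0 < δ ^ k := by positivity
    have hq := quadratic_lower_bound hsup hlip x (δ ^ k * d)
    rw [pow_succ]
    clear hle hm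
    generalize δ ^ k = t at *
    have e1 : f x = w * d := by rw [hdw]; field_simp
    have hd0 : d ≠ 0 := by rintro rfl; exact hx (by rw [e1, mul_zero])
    have hd2 : 0 < t * d ^ 2 := by positivity
    rw [e1] at hq hk
    have h1 : (1 - μ) * w * (t * d ^ 2) < L * t * (t * d ^ 2) := by nlinarith
    have h2 := lt_of_mul_lt_mul_right h1 hd2.le
    have h3 : w < 2 * (L * t) := by nlinarith
    rw [div_le_div_iff₀ (by positivity) hw0]
    nlinarith

/-- On a linear piece ending at the zero `s`, the full Newton step satisfies the Armijo condition
and decreases the distance to `s` quadratically. -/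
theorem newton_step_of_linear (hd : ∀ x, HasDerivAt h (f x) x) (hμ : μ < 1 / 2) {x s p ε d : ℝ}
    (hx : f x ≠ 0) (hp : p ≤ 0) (hlin : ∀ w ∈ uIcc x s, f w = p * (w - s))
    (hε : ε ∈ Ioc 0 |f x|) (hdir : d = -f x / (p - ε)) :
    h x + μ * f x * d ≤ h (x + d) ∧ |x + d - s| ≤ |x - s| ^ 2 := by
  obtain ⟨hε0, hε1⟩ := hε
  have hfx := hlin x left_mem_uIcc
  have hp0 : p < 0 := hp.lt_of_ne (by rintro rfl; exact hx (by rw [hfx, zero_mul]))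
  have hw : 0 < ε - p := by linarith
  have hne : p - ε ≠ 0 := by linarith
  -- The step covers a fraction in `[0, 1]` of the way to `s`, hence stays on the linear piece.
  have hdk : d = -p / (ε - p) * (s - x) := by
    rw [hdir, hfx, ← neg_sub ε p, neg_div_neg_eq]
    ring
  have hk : -p / (ε - p) ∈ Icc (0 : ℝ) 1 :=
    ⟨div_nonneg (by linarith) hw.le, (div_le_one hw).2 (by linarith)⟩
  constructor
  · have hq := primitive_of_affine hd (x := x) (d := d) (p := p) fun t ht => by
      have hmem : x + t * d ∈ uIcc x s := by
        have := (convex_uIcc x s).add_smul_sub_mem left_mem_uIcc right_mem_uIcc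
          (t := t * (-p / (ε - p)))
          ⟨mul_nonneg ht.1 hk.1, mul_le_one₀ ht.2 hk.1 hk.2⟩
        rwa [smul_eq_mul, mul_assoc, ← hdk] at this
      rw [hlin _ hmem, hfx]
      ring
    have e : f x = (ε - p) * d := by
      rw [hdir]; field_simp; ring
    rw [hq, e]
    have hd2 : 0 ≤ d ^ 2 := sq_nonneg d
    -- The Armijo slack is this quantity plus `ε * d ^ 2 / 2`.
    have : 0 ≤ (1 / 2 - μ) * (ε - p) * d ^ 2 := by
      have : 0 < 1 / 2 - μ := by linarith
      positivity
    nlinarith [mul_nonneg hε0.le hd2]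
  · have e : x + d - s = ε / (ε - p) * (x - s) := by
      rw [hdk]; field_simp; ring
    -- Here `ε ≤ |f x| = -p * |x - s|`, while `ε - p ≥ -p`.
    have h1 : ε / (ε - p) ≤ |x - s| := by
      rw [div_le_iff₀ hw]
      rw [hfx, abs_mul, abs_of_neg hp0] at hε1
      nlinarith [abs_nonneg (x - s)]
    rw [e, abs_mul, abs_of_nonneg (by positivity : 0 ≤ ε / (ε - p)), sq]
    gcongr

end Newton

/-! ### Global and local convergence -/

section Convergence

variable {f h : ℝ → ℝ}

/-- If `f` stayed positive on `[0, ∞)`, its last affine piece would have nonnegative slope, so `f`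
would be bounded away from zero there and `h` would grow past `B`. -/
theorem exists_zero_of_bounded_primitive (hsup : ∀ σ τ, h τ ≤ h σ + f σ * (τ - σ))
    (hpa : IsPiecewiseAffine f) (hc : Continuous f) (h0 : 0 < f 0) {B : ℝ}
    (hB : ∀ x ≥ 0, h x ≤ B) : ∃ s ≥ 0, f s = 0 := by
  obtain ⟨t, ht0, ht⟩ : ∃ t ≥ 0, f t ≤ 0 := by
    by_contra! hpos
    obtain ⟨T, p, q, hT⟩ := hpa.eventually_atTop
    obtain ⟨T', hT'⟩ : ∃ T', T' = max T 0 := ⟨_, rfl⟩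
    have hTT : T ≤ T' := hT' ▸ le_max_left _ _
    have hT0 : 0 ≤ T' := hT' ▸ le_max_right _ _
    have hfT := hpos T' hT0
    have hp : 0 ≤ p := by
      by_contra! hp
      have hx : 0 ≤ f T' / -p := div_nonneg hfT.le (by linarith)
      have h1 := hpos (T' + f T' / -p) (by linarith)
      have h2 : p * (f T' / -p) = -f T' := by
        have := hp.ne
        field_simp
      rw [hT _ (by linarith), mul_add, h2, hT _ hTT] at h1
      linarith
    have hge : ∀ x ≥ T', f T' ≤ f x := fun x hx => by
      rw [hT _ hTT, hT _ (hTT.trans hx)]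
      gcongr
    have hx : 0 ≤ (B - h T' + 1) / f T' :=
      div_nonneg (by linarith [hB T' hT0]) hfT.le
    -- At this point the growth of `h` from `T'` already gives `h x ≥ B + 1`.
    obtain ⟨x, hxdef⟩ : ∃ x, x = T' + (B - h T' + 1) / f T' := ⟨_, rfl⟩
    have h1 := hsup x T'
    have h2 := hB x (by linarith)
    have h3 := hge x (by linarith)
    have h4 : f T' * (x - T') = B - h T' + 1 := by rw [hxdef]; field_simp; ring
    nlinarith
  obtain ⟨s, hs, hfs⟩ := intermediate_value_Icc' ht0 hc.continuousOn ⟨ht, h0.le⟩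
  exact ⟨s, hs.1, hfs⟩

/-- The tangent at `0` bounds the superlevel set below, and a tangent of negative slope bounds it
above. Without negative slopes `f` vanishes beyond `s`, where no iterate can lie. -/
theorem isBounded_range_of_superlevel (hsup : ∀ σ τ, h τ ≤ h σ + f σ * (τ - σ)) (h0 : 0 < f 0)
    {s : ℝ} (hs : f s = 0) {σ : ℕ → ℝ} {c : ℝ} (hσ : ∀ j, c ≤ h (σ j)) (hne : ∀ j, f (σ j) ≠ 0) :
    Bornology.IsBounded (range σ) := by
  have hanti := antitone_of_supergradient hsup
  have hlow : ∀ j, (c - h 0) / f 0 ≤ σ j := fun j => by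
    rw [div_le_iff₀ h0]
    linarith [hsup 0 (σ j), hσ j]
  obtain ⟨M, hM⟩ : ∃ M, ∀ j, σ j ≤ M := by
    by_cases hneg : ∃ t, f t < 0
    · obtain ⟨t, ht⟩ := hneg
      refine ⟨t + (c - h t) / f t, fun j => ?_⟩
      rw [← sub_le_iff_le_add', le_div_iff_of_neg ht]
      linarith [hsup t (σ j), hσ j]
    · push Not at hneg
      refine ⟨s, fun j => ?_⟩
      by_contra! hlt
      exact hne j (le_antisymm (hs ▸ hanti hlt.le) (hneg _))
  refine (Metric.isBounded_Icc ((c - h 0) / f 0) M).subset ?_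
  rintro _ ⟨j, rfl⟩
  exact ⟨hlow j, hM j⟩

theorem tendsto_zero_of_sq_le_increment {g u : ℕ → ℝ} {c B : ℝ} (hc : 0 < c)
    (hB : ∀ j, u j ≤ B) (hinc : ∀ j, u j + c * g j ^ 2 ≤ u (j + 1)) :
    Tendsto g atTop (𝓝 0) := by
  have hmono : Monotone u := monotone_nat_of_le_succ fun j => by
    have := hinc j
    have : 0 ≤ c * g j ^ 2 := by positivity
    linarith
  have hu := tendsto_atTop_ciSup hmono ⟨B, by rintro _ ⟨j, rfl⟩; exact hB j⟩
  have hdiff : Tendsto (fun j => (u (j + 1) - u j) / c) atTop (𝓝 0) := by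
    have := ((hu.comp (tendsto_add_atTop_nat 1)).sub hu).div_const c
    simpa using this
  have hsq : Tendsto (fun j => g j ^ 2) atTop (𝓝 0) :=
    squeeze_zero (fun j => sq_nonneg _) (fun j => by
      rw [le_div_iff₀ hc]
      linarith [hinc j]) hdiff
  have := hsq.sqrt
  simp only [Real.sqrt_sq_eq_abs, Real.sqrt_zero] at this
  exact (tendsto_zero_iff_abs_tendsto_zero _).2 this

/-- A sequence that contracts quadratically near one of its cluster points converges to it. -/
theorem quadratic_convergence_of_local_step {σ : ℕ → ℝ} {s r : ℝ} (hr : 0 < r)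
    (hs : MapClusterPt s atTop σ)
    (hstep : ∀ j, |σ j - s| < r → |σ (j + 1) - s| ≤ |σ j - s| ^ 2) :
    Tendsto σ atTop (𝓝 s) ∧ (fun j => |σ (j + 1) - s|) =O[atTop] fun j => |σ j - s| ^ 2 := by
  -- Within distance `1 / 2`, squaring at least halves the error, so the sequence never leaves the
  -- ball again.
  obtain ⟨j₀, hj₀⟩ : ∃ j, σ j ∈ Metric.ball s (min r (1 / 2)) :=
    (hs.frequently (Metric.ball_mem_nhds s (by positivity))).exists
  rw [Metric.mem_ball, Real.dist_eq, lt_min_iff] at hj₀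
  have hk : ∀ k, |σ (k + j₀) - s| < r ∧ |σ (k + j₀) - s| ≤ (1 / 2) ^ (k + 1) := by
    intro k
    induction k with
    | zero => exact ⟨by simpa using hj₀.1, by simpa using hj₀.2.le⟩
    | succ k ih =>
      have h1 := hstep _ ih.1
      rw [show k + 1 + j₀ = k + j₀ + 1 by ring]
      have hpow : ((1 : ℝ) / 2) ^ (k + 1) ≤ 1 / 2 := by
        rw [pow_succ]
        have : ((1 : ℝ) / 2) ^ k ≤ 1 := pow_le_one₀ (by norm_num) (by norm_num)
        linarith
      have h2 : |σ (k + j₀) - s| ^ 2 ≤ |σ (k + j₀) - s| * (1 / 2) := by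
        rw [sq]
        gcongr
        exact ih.2.trans hpow
      refine ⟨?_, ?_⟩
      · linarith [abs_nonneg (σ (k + j₀) - s), ih.1]
      · rw [pow_succ _ (k + 1)]
        linarith [ih.2]
  constructor
  · rw [← tendsto_add_atTop_iff_nat j₀, tendsto_iff_dist_tendsto_zero]
    refine squeeze_zero (fun _ => dist_nonneg) (fun k => ?_)
      ((tendsto_pow_atTop_nhds_zero_of_lt_one (r := (1 / 2 : ℝ)) (by norm_num)
        (by norm_num)).comp (tendsto_add_atTop_nat 1))
    rw [Real.dist_eq]
    exact (hk k).2
  · refine IsBigO.of_bound 1 ?_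
    filter_upwards [eventually_ge_atTop j₀] with j hj
    obtain ⟨k, rfl⟩ := Nat.exists_eq_add_of_le' hj
    rw [Real.norm_eq_abs, abs_abs, one_mul, Real.norm_of_nonneg (by positivity)]
    exact hstep _ (hk k).1

end Convergence

/-! ### The main theorem -/

theorem mainTheorem2 {n : ℕ} (y a : EuclideanSpace ℝ (Fin n)) (b : ℝ)
    (hfeas : (feasibleSet a b).Nonempty)
    (hab : a ≠ WithLp.toLp 2 (fun _ => b))
    (μ δ τ₁ τ₂ : ℝ) (hμ : μ ∈ Ioo (0 : ℝ) (1 / 2)) (hδ : δ ∈ Ioo (0 : ℝ) 1)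
    (hτ₁ : τ₁ ∈ Ioo (0 : ℝ) 1) (hτ₂ : τ₂ ∈ Ioc (0 : ℝ) 1)
    (σ v : ℕ → ℝ) (m : ℕ → ℕ) (hσ : IsSSNSequence y a b μ δ τ₁ τ₂ σ v m) :
    Bornology.IsBounded (range σ) ∧
      ∀ s : ℝ, MapClusterPt s atTop σ →
        IsDualSolution y a b s ∧ Tendsto σ atTop (𝓝 s) ∧
          (fun j => |σ (j + 1) - s|) =O[atTop] (fun j => |σ j - s| ^ 2) := by
  obtain ⟨x₀, hx₀b, hx₀⟩ := hfeas
  have hn : 0 < n := by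
    rcases Nat.eq_zero_or_pos n with rfl | h
    · simpa using hx₀.2
    · exact h
  obtain ⟨L, hLdef⟩ : ∃ L, L = ‖a‖ ^ 2 + 1 := ⟨_, rfl⟩
  have hL : 0 < L := by rw [hLdef]; positivity
  have hsup := dualFun_le_add_psi_mul y a b hn
  have hlip := abs_psi_sub_le y a b hn
  rw [← hLdef] at hlip
  have hpa := psi_isPiecewiseAffine hn y a b
  have hB : ∀ x ≥ 0, dualFun y a b x ≤ 1 / 2 * ‖x₀ - y‖ ^ 2 := fun x hx => by
    have h1 := dualFun_le_lagrangian y a b hn x hx₀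
    rw [lagrangian] at h1
    nlinarith
  obtain ⟨h0, hns, hcl, hls, hup⟩ := hσ.psi_zero_pos, hσ.not_stopped, hσ.mem_clarke,
    hσ.line_search, hσ.update
  simp only [newtonDir] at hls hup
  -- From here on only the scalar properties of `ψ` and `h` collected above are used.
  generalize psi y a b = f at *
  unfold IsDualSolution
  generalize dualFun y a b = h at *
  have hanti := antitone_of_supergradient hsup
  have hc : Continuous f :=
    (LipschitzWith.of_dist_le_mul (K := ⟨L, hL.le⟩) fun x z => hlip x z).continuous
  have hderiv := hasDerivAt_of_supergradient hsup hlip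
  obtain ⟨s₀, -, hs₀⟩ := exists_zero_of_bounded_primitive hsup hpa hc h0 hB
  have hmax : ∀ s, f s = 0 → ∀ x, h x ≤ h s := fun s hs x => by simpa [hs] using hsup s x
  have hne : ∀ j, f (σ j) ≠ 0 := fun j => abs_pos.1 (hns j)
  have hv : ∀ j, v j ∈ Icc (-L) 0 := fun j => clarkeDiff_subset_Icc hanti hlip hL.le _ (hcl j)
  have hε0 : ∀ j, 0 < τ₂ * min τ₁ |f (σ j)| := fun j => mul_pos hτ₂.1 (lt_min hτ₁.1 (hns j))
  have hεle : ∀ j, τ₂ * min τ₁ |f (σ j)| ≤ min τ₁ |f (σ j)| := fun j =>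
    mul_le_of_le_one_left (lt_min hτ₁.1 (hns j)).le hτ₂.2
  have hinc : ∀ j, h (σ j) + μ * min (δ / (2 * L)) (1 / (L + 1)) * f (σ j) ^ 2
      ≤ h (σ (j + 1)) := fun j => by
    rw [hup j]
    exact armijo_increase hsup hlip hL hμ hδ (hne j) (hv j)
      ⟨hε0 j, (hεle j).trans ((min_le_left _ _).trans hτ₁.2.le)⟩ rfl (hls j)
  have hcpos : 0 < μ * min (δ / (2 * L)) (1 / (L + 1)) :=
    mul_pos hμ.1 (lt_min (div_pos hδ.1 (by positivity)) (by positivity))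
  have hmono : Monotone fun j => h (σ j) := monotone_nat_of_le_succ fun j => by
    have := mul_nonneg hcpos.le (sq_nonneg (f (σ j)))
    linarith [hinc j]
  refine ⟨isBounded_range_of_superlevel hsup h0 hs₀ (fun j => hmono (Nat.zero_le j)) hne,
    fun s hs => ?_⟩
  have hf0 : Tendsto (fun j => f (σ j)) atTop (𝓝 0) :=
    tendsto_zero_of_sq_le_increment hcpos (fun j => hmax s₀ hs₀ (σ j)) hinc
  have hfs : f s = 0 := by
    have : MapClusterPt (f s) atTop (fun j => f (σ j)) := hs.continuousAt_comp hc.continuousAt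
    exact eq_of_nhds_neBot (this.neBot.mono (inf_le_inf_left _ hf0))
  refine ⟨⟨?_, fun x _ => hmax s hfs x⟩, ?_⟩
  -- A negative zero is impossible: `ψ` is antitone and `ψ(0) > 0`.
  · by_contra! hlt
    have := hanti (not_le.1 hlt).le
    linarith
  · obtain ⟨r, hr, hloc⟩ := hpa.exists_near_zero hc hfs
    refine quadratic_convergence_of_local_step hr hs fun j hj => ?_
    obtain ⟨p, hlin, hev⟩ := hloc _ hj fun he => hne j (he ▸ hfs)
    obtain rfl : v j = p := clarkeDiff_subset_singleton hev (hcl j)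
    obtain ⟨hacc, hquad⟩ := newton_step_of_linear hderiv hμ.2 (hne j) (hv j).2 hlin
      ⟨hε0 j, (hεle j).trans (min_le_right _ _)⟩ rfl
    -- The full step passes the Armijo test, so the least exponent is zero.
    have hm : m j = 0 := Nat.le_zero.1 ((hls j).2 (by simpa using hacc))
    rw [hup j, hm, pow_zero, one_mul]
    exact hquad
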